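/- Let $\Gamma_3$ be the closed region of the plane bounded by the parabolas $y^2=1+2x$ and $y^2=1-2x$, the $x$-axis and the line $y=2/3$, that is, \[ \Gamma_3=\{(x,y)\in\mathbb R^2 : y^2\le 1+2x,\; y^2\le 1-2x,\; 0\le y\le 2/3\}. \] Let $G_3$ be the group of motions of the plane that consist of a rotation by an integer multiple of $2\pi/3$ followed by a translation. Then $\Gamma_3$ is a convex $G_3$-covering of the set of all closed curves of length $2$: $\Gamma_3$ is convex, and for every closed curve $\gamma$ of length $2$ in the plane there is $g\in G_3$ such that $g\gamma\subseteq\Gamma_3$. Moreover, the area of $\Gamma_3$ is $46/81$, and $46/81<0.568$. -/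

import Mathlib

/-! The Euclidean plane is `ℂ`: the point `(x, y)` is `x + y i`, with `x = z.re`, `y = z.im`. -/

/-- The group `G_k = T ⋊ Z_k` of all motions of the plane that consist of a rotation by an integer
multiple of `2π/k` followed by a translation. -/
noncomputable def rotTransGroup (k : ℕ) : Subgroup (ℂ ≃ᵃⁱ[ℝ] ℂ) where
  carrier := {g | ∃ (i : ℤ) (v : ℂ),
    ∀ z : ℂ, g z = Complex.exp (((2 * Real.pi * i / k : ℝ) : ℂ) * Complex.I) * z + v}
  one_mem' := ⟨0, 0, fun z => by simp⟩
  mul_mem' := by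
    rintro g h ⟨i, v, hg⟩ ⟨j, w, hh⟩
    refine ⟨i + j, Complex.exp (((2 * Real.pi * i / k : ℝ) : ℂ) * Complex.I) * w + v, fun z => ?_⟩
    have hexp : Complex.exp (((2 * Real.pi * (i + j : ℤ) / k : ℝ) : ℂ) * Complex.I)
        = Complex.exp (((2 * Real.pi * i / k : ℝ) : ℂ) * Complex.I)
          * Complex.exp (((2 * Real.pi * j / k : ℝ) : ℂ) * Complex.I) := by
      rw [← Complex.exp_add]
      congr 1
      push_cast
      ring
    rw [AffineIsometryEquiv.coe_mul, Function.comp_apply, hh, hg, hexp]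
    ring
  inv_mem' := by
    rintro g ⟨i, v, hg⟩
    refine ⟨-i, -(Complex.exp (((2 * Real.pi * (-i : ℤ) / k : ℝ) : ℂ) * Complex.I) * v),
      fun z => ?_⟩
    have hexp : Complex.exp (((2 * Real.pi * (-i : ℤ) / k : ℝ) : ℂ) * Complex.I)
        * Complex.exp (((2 * Real.pi * i / k : ℝ) : ℂ) * Complex.I) = 1 := by
      rw [← Complex.exp_add, ← Complex.exp_zero]
      congr 1
      push_cast
      ring
    have hz : g (g⁻¹ z) = z := g.apply_symm_apply z
    rw [hg] at hz
    linear_combination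
      Complex.exp (((2 * Real.pi * (-i : ℤ) / k : ℝ) : ℂ) * Complex.I) * hz - (g⁻¹ z) * hexp

/-- The (images of) closed curves of length `ℓ` in the plane. A closed curve is a continuous
`γ : [0, 1] → ℂ` with `γ 0 = γ 1`; its length is the supremum of the lengths of the inscribed
polygonal lines, that is, the variation of `γ`. -/
def closedCurves (ℓ : ENNReal) : Set (Set ℂ) :=
  {C | ∃ γ : ℝ → ℂ, ContinuousOn γ (Set.Icc 0 1) ∧ γ 0 = γ 1 ∧
    eVariationOn γ (Set.Icc 0 1) = ℓ ∧ C = γ '' Set.Icc 0 1}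

/-- `K` is a `G`-covering of the family `S` of planar objects: every object of `S` is carried into
`K` by some transformation in `G`. -/
def IsGCovering (G : Subgroup (ℂ ≃ᵃⁱ[ℝ] ℂ)) (S : Set (Set ℂ)) (K : Set ℂ) : Prop :=
  ∀ C ∈ S, ∃ g ∈ G, g '' C ⊆ K

/-- The closed region that is bounded by the parabolas `y² = 1 + 2x` and `y² = 1 - 2x` and
contains the origin. -/
def parabolaRegion : Set ℂ :=
  {z | z.im ^ 2 ≤ 1 + 2 * z.re ∧ z.im ^ 2 ≤ 1 - 2 * z.re}

/-- The part `Γ₃` of that region between the `x`-axis and the line `y = 2/3`. -/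
def Gamma3 : Set ℂ :=
  {z | z ∈ parabolaRegion ∧ 0 ≤ z.im ∧ z.im ≤ 2 / 3}

/-! A closed curve of length 2 has, in some direction among three spaced by 2π/3, width at most 2/3:
its widths in these directions add up to at most 2 (`abs_im_rotations_sum_le`, summed over the edges
of an inscribed polygon). Rotate so that this direction is vertical, rest the curve on the x-axis,
and slide it until it touches the right parabola. The contact point, any other point and the lowest
point form a triangle of perimeter at most 2, and reflection in the axis shows that the other point
satisfies the left parabola's inequality (`re_sub_add_sq_im_le_one`). The area is the integral of
the slice lengths `1 - y ^ 2`. -/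

open MeasureTheory in
theorem volume_Gamma3 : volume Gamma3 = ENNReal.ofReal (46 / 81) := by
  have hm : MeasurableSet {p : ℝ × ℝ | (p.2 ^ 2 ≤ 1 + 2 * p.1 ∧ p.2 ^ 2 ≤ 1 - 2 * p.1) ∧
      0 ≤ p.2 ∧ p.2 ≤ 2 / 3} := by
    measurability
  have h1 : Gamma3 = Complex.measurableEquivRealProd ⁻¹'
      {p : ℝ × ℝ | (p.2 ^ 2 ≤ 1 + 2 * p.1 ∧ p.2 ^ 2 ≤ 1 - 2 * p.1) ∧
      0 ≤ p.2 ∧ p.2 ≤ 2 / 3} := rfl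
  rw [h1, Complex.volume_preserving_equiv_real_prod.measure_preimage hm.nullMeasurableSet,
    Measure.volume_eq_prod, Measure.prod_apply_symm hm]
  have h2 : ∀ y : ℝ, volume ((fun x : ℝ => (x, y)) ⁻¹'
      {p : ℝ × ℝ | (p.2 ^ 2 ≤ 1 + 2 * p.1 ∧ p.2 ^ 2 ≤ 1 - 2 * p.1) ∧ 0 ≤ p.2 ∧ p.2 ≤ 2 / 3}) =
      (Set.Icc (0 : ℝ) (2 / 3)).indicator (fun y => ENNReal.ofReal (1 - y ^ 2)) y := by
    intro y
    by_cases hy : y ∈ Set.Icc (0 : ℝ) (2 / 3)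
    · rw [Set.indicator_of_mem hy]
      have : (fun x : ℝ => (x, y)) ⁻¹' {p : ℝ × ℝ | (p.2 ^ 2 ≤ 1 + 2 * p.1 ∧
          p.2 ^ 2 ≤ 1 - 2 * p.1) ∧ 0 ≤ p.2 ∧ p.2 ≤ 2 / 3} =
          Set.Icc (-(1 - y ^ 2) / 2) ((1 - y ^ 2) / 2) := by
        ext x
        simp only [Set.mem_preimage, Set.mem_ofPred_eq, Set.mem_Icc]
        constructor
        · rintro ⟨⟨h, h'⟩, -⟩
          constructor <;> linarith
        · rintro ⟨h, h'⟩
          exact ⟨⟨by linarith, by linarith⟩, hy⟩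
      rw [this, Real.volume_Icc]
      congr 1
      ring
    · rw [Set.indicator_of_notMem hy]
      convert measure_empty (μ := (volume : Measure ℝ))
      ext x
      simp only [Set.mem_preimage, Set.mem_ofPred_eq, Set.mem_empty_iff_false, iff_false]
      exact fun h => hy h.2
  simp_rw [h2]
  rw [lintegral_indicator measurableSet_Icc,
    ← ofReal_integral_eq_lintegral_ofReal
      ((by fun_prop : Continuous fun y : ℝ => 1 - y ^ 2).integrableOn_Icc)]
  · rw [integral_Icc_eq_integral_Ioc,
      ← intervalIntegral.integral_of_le (by norm_num : (0 : ℝ) ≤ 2 / 3)]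
    congr 1
    rw [intervalIntegral.integral_sub (by simp) (by simp), integral_pow]
    norm_num
  · filter_upwards [ae_restrict_mem measurableSet_Icc] with y hy
    have := hy.1
    have := hy.2
    simp only [Pi.zero_apply]
    nlinarith

theorem convex_Gamma3 : Convex ℝ Gamma3 := by
  rintro z ⟨⟨h1, h2⟩, h3, h4⟩ w ⟨⟨k1, k2⟩, k3, k4⟩ a b ha hb hab
  have hsq : (a * z.im + b * w.im) ^ 2 ≤ a * z.im ^ 2 + b * w.im ^ 2 := by
    obtain rfl : b = 1 - a := by linarith
    nlinarith [mul_nonneg (mul_nonneg ha hb) (sq_nonneg (z.im - w.im))]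
  have e1 := mul_le_mul_of_nonneg_left h1 ha
  have e2 := mul_le_mul_of_nonneg_left h2 ha
  have e3 := mul_le_mul_of_nonneg_left k1 hb
  have e4 := mul_le_mul_of_nonneg_left k2 hb
  have e5 := mul_le_mul_of_nonneg_left h4 ha
  have e6 := mul_le_mul_of_nonneg_left k4 hb
  have e7 := mul_nonneg ha h3
  have e8 := mul_nonneg hb k3
  refine ⟨⟨?_, ?_⟩, ?_, ?_⟩ <;> simp <;> nlinarith

/-! ### Polygons inscribed in closed curves -/

/-- The perimeter of a triangle inscribed in a closed polygon is at most that of the polygon. -/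
theorem triangle_perimeter_le_sum {α : Type*} [PseudoMetricSpace α] {f : ℕ → α} {n : ℕ}
    (h0 : f 0 = f n) {a b c : ℕ} (ha : a ≤ n) (hb : b ≤ n) (hc : c ≤ n) :
    dist (f a) (f b) + dist (f b) (f c) + dist (f c) (f a) ≤
      ∑ i ∈ Finset.range n, dist (f i) (f (i + 1)) := by
  have key : ∀ {a b c : ℕ}, a ≤ b → b ≤ c → c ≤ n →
      dist (f a) (f b) + dist (f b) (f c) + dist (f c) (f a) ≤
        ∑ i ∈ Finset.range n, dist (f i) (f (i + 1)) := by
    intro a b c hab hbc hc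
    have e1 := dist_le_Ico_sum_dist f (Nat.zero_le a)
    have e2 := dist_le_Ico_sum_dist f hab
    have e3 := dist_le_Ico_sum_dist f hbc
    have e4 := dist_le_Ico_sum_dist f hc
    have e5 := dist_triangle (f c) (f n) (f a)
    rw [← h0] at e5
    rw [← h0] at e4
    rw [Finset.range_eq_Ico, ← Finset.sum_Ico_consecutive _ (Nat.zero_le a) (hab.trans (hbc.trans hc)),
      ← Finset.sum_Ico_consecutive _ hab (hbc.trans hc), ← Finset.sum_Ico_consecutive _ hbc hc]
    linarith
  have c1 := dist_comm (f a) (f b)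
  have c2 := dist_comm (f b) (f c)
  have c3 := dist_comm (f c) (f a)
  rcases le_total a b with hab | hab <;> rcases le_total b c with hbc | hbc <;>
    rcases le_total c a with hca | hca
  · linarith [key hab hbc hc]
  · linarith [key hab hbc hc]
  · linarith [key hca hab hb]
  · linarith [key hca hbc hb]
  · linarith [key hbc hca ha]
  · linarith [key hab hca hc]
  · linarith [key hbc hab ha]
  · linarith [key hbc hab ha]

/-- Finitely many points of a closed curve lie on a closed polygon inscribed in it. -/
theorem exists_inscribed_polygon {α : Type*} [PseudoMetricSpace α] {γ : ℝ → α} {ℓ : ℝ}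
    (hℓ : 0 ≤ ℓ) (hγ : γ 0 = γ 1) (hv : eVariationOn γ (Set.Icc 0 1) ≤ ENNReal.ofReal ℓ)
    (T : Finset ℝ) (hT : ∀ t ∈ T, t ∈ Set.Icc (0 : ℝ) 1) :
    ∃ (P : ℕ → α) (n : ℕ), P 0 = P n ∧ (∀ t ∈ T, ∃ j ≤ n, P j = γ t) ∧
      ∑ i ∈ Finset.range n, dist (P i) (P (i + 1)) ≤ ℓ := by
  classical
  set S : Finset ℝ := insert 0 (insert 1 T) with hS
  have hSI : ∀ t ∈ S, t ∈ Set.Icc (0 : ℝ) 1 := by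
    intro t ht
    simp only [hS, Finset.mem_insert] at ht
    rcases ht with rfl | rfl | ht
    · simp
    · simp
    · exact hT t ht
  have hpos : 0 < S.card := Finset.card_pos.2 ⟨0, by simp [hS]⟩
  set n := S.card - 1
  -- Clamping the index at `n` makes `u` monotone on all of `ℕ`.
  let u : ℕ → ℝ := fun i => S.orderEmbOfFin rfl ⟨min i n, by omega⟩
  have hmono : Monotone u := by
    intro i j hij
    apply (S.orderEmbOfFin rfl).monotone
    exact min_le_min_right n hij
  have humem : ∀ i, u i ∈ S := fun i => S.orderEmbOfFin_mem rfl _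
  have hsurj : ∀ t ∈ S, ∃ j ≤ n, u j = t := by
    intro t ht
    have : t ∈ Set.range (S.orderEmbOfFin rfl) := by
      rw [Finset.range_orderEmbOfFin]
      exact ht
    obtain ⟨j, hj⟩ := this
    have hjn : (j : ℕ) ≤ n := by omega
    refine ⟨j, hjn, ?_⟩
    rw [← hj]
    simp only [u]
    congr 1
    ext
    exact min_eq_left hjn
  have hu0 : u 0 = 0 := by
    obtain ⟨j, -, hj⟩ := hsurj 0 (by simp [hS])
    exact le_antisymm (hj ▸ hmono (Nat.zero_le j)) (hSI _ (humem 0)).1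
  have hun : u n = 1 := by
    obtain ⟨j, hjn, hj⟩ := hsurj 1 (by simp [hS])
    exact le_antisymm (hSI _ (humem n)).2 (hj ▸ hmono hjn)
  refine ⟨fun i => γ (u i), n, by simp only [hu0, hun, hγ], ?_, ?_⟩
  · intro t ht
    obtain ⟨j, hjn, hj⟩ := hsurj t (by simp [hS, ht])
    exact ⟨j, hjn, congrArg γ hj⟩
  · have h := (eVariationOn.sum_le (f := γ) (n := n) hmono (fun i => hSI _ (humem i))).trans hv
    rw [← ENNReal.ofReal_le_ofReal_iff hℓ,
      ENNReal.ofReal_sum_of_nonneg fun _ _ => dist_nonneg]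
    refine le_trans (le_of_eq ?_) h
    refine Finset.sum_congr rfl fun i _ => ?_
    rw [← edist_dist, edist_comm]

/-! ### Widths and parabolas: two planar inequalities -/

theorem abs_im_rotations_sum_le (z : ℂ) {w : ℂ} (hre : w.re = -1 / 2)
    (him : w.im ^ 2 = 3 / 4) : |z.im| + |(w * z).im| + |(w ^ 2 * z).im| ≤ 2 * ‖z‖ := by
  have hn : ‖z‖ ^ 2 = z.re ^ 2 + z.im ^ 2 := by
    rw [Complex.sq_norm, Complex.normSq_apply]
    ring
  have h0 := norm_nonneg z
  have hy : |z.im| ≤ ‖z‖ := Complex.abs_im_le_norm z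
  have e1 : (w * z).im = w.im * z.re - z.im / 2 := by
    rw [Complex.mul_im, hre]
    ring
  have e2 : (w ^ 2 * z).im = -(w.im * z.re) - z.im / 2 := by
    rw [sq, Complex.mul_im, Complex.mul_im, Complex.mul_re, hre]
    linear_combination (-z.im) * him
  rw [e1, e2]
  set x := w.im * z.re with hx
  have hx2 : x ^ 2 = 3 / 4 * z.re ^ 2 := by rw [hx, mul_pow, him]
  -- The sum of absolute values is `2 * |z.im|` or `2 * |x| + |z.im|`; Cauchy–Schwarz bounds the
  -- latter, with equality at `s = 3 / 2 * t`.
  have key : ∀ s t : ℝ, s ^ 2 = x ^ 2 → t ^ 2 = z.im ^ 2 → 2 * s + t ≤ 2 * ‖z‖ := by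
    intro s t hs ht
    apply le_of_sq_le_sq _ (by positivity)
    nlinarith [sq_nonneg (s - 3 / 2 * t)]
  have k1 := key x z.im rfl rfl
  have k2 := key (-x) z.im (by ring) rfl
  have k3 := key x (-z.im) rfl (by ring)
  have k4 := key (-x) (-z.im) (by ring) (by ring)
  rcases abs_cases z.im with ⟨h1, -⟩ | ⟨h1, -⟩ <;>
    rcases abs_cases (x - z.im / 2) with ⟨h2, -⟩ | ⟨h2, -⟩ <;>
    rcases abs_cases (-x - z.im / 2) with ⟨h3, -⟩ | ⟨h3, -⟩ <;>
    rw [h1, h2, h3] <;> rw [h1] at hy <;> linarith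

/-- The key inequality for a triangle of perimeter at most `2` in the upper half-plane with a
vertex on the real axis. -/
theorem re_sub_add_sq_im_le_one {p q r : ℂ} (hp : 0 ≤ p.im) (hq : 0 ≤ q.im) (hr : r.im = 0)
    (h : dist p q + dist q r + dist r p ≤ 2) :
    p.re - q.re + (p.im ^ 2 + q.im ^ 2) / 2 ≤ 1 := by
  -- Reflecting `q` in the real axis unfolds the path from `p` to `r` to `q`.
  set a := dist p (starRingEnd ℂ q) with ha
  set b := dist p q with hb
  have hqr : dist q r = dist r (starRingEnd ℂ q) := by
    rw [← Complex.dist_conj_conj, Complex.conj_eq_iff_im.2 hr, dist_comm]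
  have hab : a + b ≤ 2 := by
    have := dist_triangle p r (starRingEnd ℂ q)
    rw [dist_comm p r] at this
    linarith
  have a2 : a ^ 2 = (p.re - q.re) ^ 2 + (p.im + q.im) ^ 2 := by
    rw [ha, Complex.dist_eq, Complex.sq_norm, Complex.normSq_apply]
    simp
    ring
  have b2 : b ^ 2 = (p.re - q.re) ^ 2 + (p.im - q.im) ^ 2 := by
    rw [hb, Complex.dist_eq, Complex.sq_norm, Complex.normSq_apply]
    simp
    ring
  have a0 : 0 ≤ a := dist_nonneg
  have b0 : 0 ≤ b := dist_nonneg
  have hba : b ≤ a := by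
    apply le_of_sq_le_sq _ a0
    nlinarith [mul_nonneg hp hq]
  have hdb : p.re - q.re ≤ b := by
    apply le_of_sq_le_sq _ b0
    nlinarith [sq_nonneg (p.im - q.im)]
  have h1 : a ^ 2 ≤ (2 - b) ^ 2 := pow_le_pow_left₀ a0 (by linarith) 2
  -- Since `a ^ 2 - b ^ 2 = 4 * p.im * q.im`, `h1` reads `b ≤ 1 - p.im * q.im`. With `d = p.re -
  -- q.re`, the rest is `d + (b ^ 2 - d ^ 2) / 2 ≤ b`, that is, `0 ≤ (b - d) * (2 - b - d)`.
  nlinarith [mul_nonneg (sub_nonneg.2 hdb) (by linarith : 0 ≤ 2 - b - (p.re - q.re))]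

/-- A compact set in the strip whose inscribed triangles have perimeter at most `2` can be
translated into `Gamma3`. -/
theorem exists_translation_subset_Gamma3 {C : Set ℂ} (hC : IsCompact C) (hne : C.Nonempty)
    (hper : ∀ p ∈ C, ∀ q ∈ C, ∀ r ∈ C, dist p q + dist q r + dist r p ≤ 2)
    (hwidth : ∀ p ∈ C, ∀ q ∈ C, p.im - q.im ≤ 2 / 3) :
    ∃ v : ℂ, ∀ z ∈ C, z + v ∈ Gamma3 := by
  obtain ⟨r, hr, hrmin⟩ := hC.exists_isMinOn hne Complex.continuous_im.continuousOn
  obtain ⟨m, hm, hmax⟩ := hC.exists_isMaxOn hne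
    (f := fun z => z.re + (z.im - r.im) ^ 2 / 2) (by fun_prop)
  -- This puts `r` on the x-axis and `m` on the parabola `y² = 1 - 2x`.
  refine ⟨⟨1 / 2 - (m.re + (m.im - r.im) ^ 2 / 2), -r.im⟩, fun z hz => ?_⟩
  have h1 : r.im ≤ z.im := hrmin hz
  have h2 : r.im ≤ m.im := hrmin hm
  have h3 : z.re + (z.im - r.im) ^ 2 / 2 ≤ m.re + (m.im - r.im) ^ 2 / 2 := hmax hz
  have h4 := hper m hm z hz r hr
  set s : ℂ := ⟨0, r.im⟩ with hs
  have h5 := re_sub_add_sq_im_le_one (p := m - s) (q := z - s) (r := r - s)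
    (by simp [hs, h2]) (by simp [hs, h1]) (by simp [hs]) (by simpa only [dist_sub_right] using h4)
  simp only [Complex.sub_re, Complex.sub_im, hs] at h5
  have h6 := hwidth z hz r hr
  refine ⟨⟨?_, ?_⟩, ?_, ?_⟩ <;> simp only [Complex.add_re, Complex.add_im] <;> nlinarith

/-! ### Choice of the rotation and the covering property -/

theorem exp_two_pi_div_three_re_im :
    (Complex.exp (((2 * Real.pi / 3 : ℝ) : ℂ) * Complex.I)).re = -1 / 2 ∧
    (Complex.exp (((2 * Real.pi / 3 : ℝ) : ℂ) * Complex.I)).im ^ 2 = 3 / 4 := by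
  have hc : Real.cos (2 * Real.pi / 3) = -1 / 2 := by
    rw [show 2 * Real.pi / 3 = Real.pi - Real.pi / 3 by ring, Real.cos_pi_sub,
      Real.cos_pi_div_three]
    norm_num
  refine ⟨by rw [Complex.exp_ofReal_mul_I_re, hc], ?_⟩
  rw [Complex.exp_ofReal_mul_I_im, Real.sin_sq, hc]
  norm_num

/-- `z ↦ ω ^ k * z + v` with `ω = exp (2πi/3)` belongs to the group `G₃`. -/
theorem exists_mem_rotTransGroup_three (k : ℕ) (v : ℂ) : ∃ g ∈ rotTransGroup 3, ∀ z : ℂ,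
    g z = Complex.exp (((2 * Real.pi / 3 : ℝ) : ℂ) * Complex.I) ^ k * z + v := by
  have hz : ∀ z : ℂ, ((rotation (Circle.exp (2 * Real.pi * k / 3))).toAffineIsometryEquiv.trans
      (AffineIsometryEquiv.constVAdd ℝ ℂ v)) z =
        Complex.exp (((2 * Real.pi * k / 3 : ℝ) : ℂ) * Complex.I) * z + v := by
    intro z
    simp [Circle.coe_exp, add_comm]
  refine ⟨(rotation (Circle.exp (2 * Real.pi * k / 3))).toAffineIsometryEquiv.trans
    (AffineIsometryEquiv.constVAdd ℝ ℂ v), ⟨(k : ℤ), v, fun z => ?_⟩, fun z => ?_⟩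
  · rw [hz]
    push_cast
    rfl
  · rw [hz, ← Complex.exp_nat_mul]
    congr 3
    push_cast
    ring

/-- Some rotation by a multiple of `2π/3` gives a closed curve of length at most `2` a vertical
width of at most `2/3`. -/
theorem exists_rotation_width_le {γ : ℝ → ℂ} (hc : ContinuousOn γ (Set.Icc 0 1))
    (hγ : γ 0 = γ 1) (hv : eVariationOn γ (Set.Icc 0 1) ≤ ENNReal.ofReal 2) {w : ℂ}
    (hre : w.re = -1 / 2) (him : w.im ^ 2 = 3 / 4) :
    ∃ k : ℕ, ∀ s ∈ Set.Icc (0 : ℝ) 1, ∀ t ∈ Set.Icc (0 : ℝ) 1,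
      (w ^ k * γ s).im - (w ^ k * γ t).im ≤ 2 / 3 := by
  classical
  have hcont : ∀ k : ℕ, ContinuousOn (fun t => (w ^ k * γ t).im) (Set.Icc 0 1) := fun k =>
    Complex.continuous_im.comp_continuousOn (continuousOn_const.mul hc)
  have hne : (Set.Icc (0 : ℝ) 1).Nonempty := ⟨0, by simp⟩
  choose lo hlo hlomin using fun k => isCompact_Icc.exists_isMinOn hne (hcont k)
  choose hi hhi hhimax using fun k => isCompact_Icc.exists_isMaxOn hne (hcont k)
  suffices h : ∃ k, (w ^ k * γ (hi k)).im - (w ^ k * γ (lo k)).im ≤ 2 / 3 by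
    obtain ⟨k, hk⟩ := h
    refine ⟨k, fun s hs t ht => ?_⟩
    have h1 : (w ^ k * γ s).im ≤ (w ^ k * γ (hi k)).im := hhimax k hs
    have h2 : (w ^ k * γ (lo k)).im ≤ (w ^ k * γ t).im := hlomin k ht
    linarith
  by_contra! hcon
  -- One polygon through all six extremal points serves the three directions at once.
  obtain ⟨P, n, h0, hP, hsum⟩ := exists_inscribed_polygon (by norm_num) hγ hv
    ((Finset.range 3).image lo ∪ (Finset.range 3).image hi) (by
      intro t ht
      simp only [Finset.mem_union, Finset.mem_image] at ht
      rcases ht with ⟨k, -, rfl⟩ | ⟨k, -, rfl⟩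
      · exact hlo k
      · exact hhi k)
  have hw : ∀ k < 3, 2 * (2 / 3) <
      ∑ i ∈ Finset.range n, |(w ^ k * (P i - P (i + 1))).im| := by
    intro k hk
    obtain ⟨a, ha, hPa⟩ := hP (hi k) (Finset.mem_union_right _
      (Finset.mem_image_of_mem _ (Finset.mem_range.2 hk)))
    obtain ⟨b, hb, hPb⟩ := hP (lo k) (Finset.mem_union_left _
      (Finset.mem_image_of_mem _ (Finset.mem_range.2 hk)))
    -- The degenerate triangle `a, b, a` gives twice the width.
    have h := triangle_perimeter_le_sum (f := fun i => (w ^ k * P i).im) (n := n)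
      (by simp only [h0]) ha hb ha
    simp only [dist_self, hPa, hPb, Real.dist_eq, add_zero] at h
    rw [abs_sub_comm (w ^ k * γ (lo k)).im] at h
    have h1 := le_abs_self ((w ^ k * γ (hi k)).im - (w ^ k * γ (lo k)).im)
    simp only [mul_sub, Complex.sub_im]
    linarith [hcon k]
  have htot : ∑ i ∈ Finset.range n, (|(w ^ 0 * (P i - P (i + 1))).im| +
      |(w ^ 1 * (P i - P (i + 1))).im| + |(w ^ 2 * (P i - P (i + 1))).im|) ≤
      ∑ i ∈ Finset.range n, 2 * dist (P i) (P (i + 1)) := by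
    refine Finset.sum_le_sum fun i _ => ?_
    rw [pow_zero, one_mul, pow_one, Complex.dist_eq]
    exact abs_im_rotations_sum_le _ hre him
  rw [Finset.sum_add_distrib, Finset.sum_add_distrib, ← Finset.mul_sum] at htot
  linarith [hw 0 (by norm_num), hw 1 (by norm_num), hw 2 (by norm_num)]

theorem isGCovering_Gamma3 : IsGCovering (rotTransGroup 3) (closedCurves 2) Gamma3 := by
  rintro _ ⟨γ, hc, hγ, hv, rfl⟩
  obtain ⟨hre, him⟩ := exp_two_pi_div_three_re_im
  have hv' : eVariationOn γ (Set.Icc 0 1) ≤ ENNReal.ofReal 2 := by simp [hv]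
  obtain ⟨k, hk⟩ := exists_rotation_width_le hc hγ hv' hre him
  set w := Complex.exp (((2 * Real.pi / 3 : ℝ) : ℂ) * Complex.I) with hw
  have hnorm : ‖w ^ k‖ = 1 := by rw [norm_pow, hw, Complex.norm_exp_ofReal_mul_I, one_pow]
  have hdist : ∀ x y : ℂ, dist (w ^ k * x) (w ^ k * y) = dist x y := fun x y => by
    rw [Complex.dist_eq, ← mul_sub, norm_mul, hnorm, one_mul, Complex.dist_eq]
  obtain ⟨v, hv2⟩ := exists_translation_subset_Gamma3
    (C := (fun t => w ^ k * γ t) '' Set.Icc 0 1)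
    (isCompact_Icc.image_of_continuousOn (continuousOn_const.mul hc))
    ⟨_, Set.mem_image_of_mem _ (Set.left_mem_Icc.2 zero_le_one)⟩ (by
      rintro _ ⟨a, ha, rfl⟩ _ ⟨b, hb, rfl⟩ _ ⟨c, hc, rfl⟩
      obtain ⟨P, n, h0, hP, hsum⟩ := exists_inscribed_polygon (by norm_num) hγ hv' {a, b, c} (by
        simp only [Finset.mem_insert, Finset.mem_singleton]
        rintro t (rfl | rfl | rfl) <;> assumption)
      obtain ⟨i, hi, hPi⟩ := hP a (by simp)
      obtain ⟨j, hj, hPj⟩ := hP b (by simp)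
      obtain ⟨l, hl, hPl⟩ := hP c (by simp)
      have h := triangle_perimeter_le_sum h0 hi hj hl
      rw [hPi, hPj, hPl] at h
      simp only [hdist]
      exact h.trans hsum) (by
      rintro _ ⟨a, ha, rfl⟩ _ ⟨b, hb, rfl⟩
      exact hk a ha b hb)
  obtain ⟨g, hg, hgz⟩ := exists_mem_rotTransGroup_three k v
  refine ⟨g, hg, ?_⟩
  rintro _ ⟨_, ⟨t, ht, rfl⟩, rfl⟩
  rw [hgz]
  exact hv2 _ ⟨t, ht, rfl⟩

theorem mainTheorem6 :
    Convex ℝ Gamma3 ∧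
    IsGCovering (rotTransGroup 3) (closedCurves 2) Gamma3 ∧
    MeasureTheory.volume Gamma3 = ENNReal.ofReal (46 / 81) ∧
    (46 / 81 : ℝ) < 0.568 :=
  ⟨convex_Gamma3, isGCovering_Gamma3, volume_Gamma3, by norm_num⟩
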